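/- Let $M$ be a smooth $n$-dimensional manifold without boundary (Hausdorff, second countable), $n\ge 0$. Let $J$ be a (possibly degenerate) Poisson tensor on $M$, that is, a smooth alternating contravariant $2$-tensor field whose bracket $\{f,g\}:=J(df,dg)$ on $C^\infty(M)$ satisfies the Jacobi identity. Let $\nu$ be a volume form on $M$, that is, a smooth nowhere vanishing $n$-form; $M$ carries the orientation given by $\nu$. For a vector field $X$, the divergence $\operatorname{div}_\nu X$ is the function defined by $\mathcal L_X\nu=\operatorname{div}_\nu(X)\,\nu$. Assume that $J$ is unimodular for $\nu$, that is, $$\operatorname{div}_\nu\bigl(J(df,\cdot)\bigr)=0\qquad\text{for all } f\in C^\infty(M),$$ where $J(df,\cdot)$ is the Hamiltonian vector field $X_f$ determined by $X_f(g)=J(df,dg)$ for all $g\in C^\infty(M)$. Then for every $f\in C^\infty(M)$ and every $h\in C_c^\infty(M)$ the function $J(df,dh)$ is integrable with respect to $\nu$ and $$\int_M J(df,dh)\,\nu=0 .$$ -/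

import Mathlib

open scoped Manifold ContDiff
open MeasureTheory

noncomputable section

namespace PoissonManifold

variable {n : ℕ} {M : Type*} [TopologicalSpace M] [ChartedSpace (EuclideanSpace ℝ (Fin n)) M]

/-- The cotangent space `T*_x M`. -/
abbrev Cotangent (x : M) : Type := Module.Dual ℝ (TangentSpace (𝓡 n) x)

/-- The differential `df` of a real function, as a covector at `x`. -/
def differential (f : M → ℝ) (x : M) : Cotangent (n := n) x :=
  (mvfderiv (𝓡 n) f x).toLinearMap

/-- Smoothness of a field of alternating `k`-forms: in every smooth chart `e`, the components of the
form in the coordinates given by `e` are smooth functions on the domain of the coordinates. -/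
def IsSmoothForm {k : ℕ} (η : ∀ x : M, TangentSpace (𝓡 n) x [⋀^Fin k]→L[ℝ] ℝ) : Prop :=
  ∀ e ∈ IsManifold.maximalAtlas (𝓡 n) ∞ M, ∀ v : Fin k → EuclideanSpace ℝ (Fin n),
    ContDiffOn ℝ ∞ (fun y => η (e.symm y) (fun i => mfderiv (𝓡 n) (𝓡 n) e.symm y (v i))) e.target

/-- Smoothness of a field of contravariant `2`-tensors: in every smooth chart `e`, its components
`J (α, β)`, with `α` and `β` covectors that are constant in the coordinates given by `e`, are
smooth functions on the domain of the coordinates. -/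
def IsSmoothContravariantTwoTensor
    (J : ∀ x : M, Cotangent (n := n) x →ₗ[ℝ] Cotangent (n := n) x →ₗ[ℝ] ℝ) : Prop :=
  ∀ e ∈ IsManifold.maximalAtlas (𝓡 n) ∞ M, ∀ α β : Module.Dual ℝ (EuclideanSpace ℝ (Fin n)),
    ContDiffOn ℝ ∞ (fun y => J (e.symm y)
      (α ∘ₗ (mfderiv (𝓡 n) (𝓡 n) e (e.symm y)).toLinearMap)
      (β ∘ₗ (mfderiv (𝓡 n) (𝓡 n) e (e.symm y)).toLinearMap)) e.target

/-- The bracket `{f, g} = J(df, dg)` of two functions. -/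
def bracket (J : ∀ x : M, Cotangent (n := n) x →ₗ[ℝ] Cotangent (n := n) x →ₗ[ℝ] ℝ)
    (f g : M → ℝ) (x : M) : ℝ :=
  J x (differential f x) (differential g x)

variable (n M) in
/-- A (possibly degenerate) Poisson tensor: a smooth alternating contravariant `2`-tensor field
whose bracket on smooth functions satisfies the Jacobi identity. -/
structure PoissonTensor where
  toFun : ∀ x : M, Cotangent (n := n) x →ₗ[ℝ] Cotangent (n := n) x →ₗ[ℝ] ℝ
  smooth : IsSmoothContravariantTwoTensor toFun
  alternating : ∀ (x : M) (α : Cotangent (n := n) x), toFun x α α = 0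
  jacobi : ∀ f g h : M → ℝ, ContMDiff (𝓡 n) 𝓘(ℝ, ℝ) ∞ f → ContMDiff (𝓡 n) 𝓘(ℝ, ℝ) ∞ g →
    ContMDiff (𝓡 n) 𝓘(ℝ, ℝ) ∞ h → ∀ x : M,
      bracket toFun f (bracket toFun g h) x + bracket toFun g (bracket toFun h f) x
        + bracket toFun h (bracket toFun f g) x = 0

instance (x : M) : Module.IsReflexive ℝ (TangentSpace (𝓡 n) x) :=
  inferInstanceAs (Module.IsReflexive ℝ (EuclideanSpace ℝ (Fin n)))

/-- The Hamiltonian vector field `X_f = J(df, ·)`: at each point `x`, the tangent vector which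
corresponds to the linear form `β ↦ J(df, β)` on `T*_x M` under the canonical isomorphism of
`T_x M` with its double dual. -/
def PoissonTensor.hamiltonianVectorField (J : PoissonTensor n M) (f : M → ℝ) (x : M) :
    TangentSpace (𝓡 n) x :=
  (Module.evalEquiv ℝ (TangentSpace (𝓡 n) x)).symm (J.toFun x (differential f x))

variable (n M) in
/-- A volume form: a smooth, nowhere vanishing differential form of top degree. -/
structure VolumeForm where
  toFun : ∀ x : M, TangentSpace (𝓡 n) x [⋀^Fin n]→L[ℝ] ℝ
  smooth : IsSmoothForm toFun
  nonvanishing : ∀ x : M, toFun x ≠ 0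

/-- The Lie derivative `L_X η` of a `k`-form, evaluated on vector fields `Y₁, …, Y_k`:
`(L_X η)(Y₁, …, Y_k) = X(η(Y₁, …, Y_k)) - ∑ᵢ η(Y₁, …, [X, Yᵢ], …, Y_k)`. -/
def lieDerivative {k : ℕ} (X : ∀ x : M, TangentSpace (𝓡 n) x)
    (η : ∀ x : M, TangentSpace (𝓡 n) x [⋀^Fin k]→L[ℝ] ℝ)
    (Y : Fin k → ∀ x : M, TangentSpace (𝓡 n) x) (x : M) : ℝ :=
  mvfderiv (𝓡 n) (fun z => η z (fun i => Y i z)) x (X x)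
    - ∑ i, η x (Function.update (fun j => Y j x) i (VectorField.mlieBracket (𝓡 n) X (Y i) x))

/-- `IsDivergence ν X g` says that the function `g` is the divergence `div_ν X`, that is,
`L_X ν = g ν`. The two sides are compared on all tuples of smooth vector fields. -/
def IsDivergence [IsManifold (𝓡 n) ∞ M] (ν : VolumeForm n M) (X : ∀ x : M, TangentSpace (𝓡 n) x)
    (g : M → ℝ) : Prop :=
  ∀ Y : Fin n → Cₛ^∞⟮𝓡 n; EuclideanSpace ℝ (Fin n), (TangentSpace (𝓡 n) : M → Type _)⟯, ∀ x : M,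
    lieDerivative X ν.toFun (fun i => Y i) x = g x * ν.toFun x (fun i => Y i x)

/-- `J` is unimodular for `ν`: `div_ν (J(df, ·)) = 0` for every smooth function `f`. -/
def IsUnimodular [IsManifold (𝓡 n) ∞ M] (J : PoissonTensor n M) (ν : VolumeForm n M) : Prop :=
  ∀ f : M → ℝ, ContMDiff (𝓡 n) 𝓘(ℝ, ℝ) ∞ f → IsDivergence ν (J.hamiltonianVectorField f) 0

/-- The density `|ν(∂₁, …, ∂ₙ)|` of a volume form in the coordinates of a chart `e`. -/
def VolumeForm.chartDensity (ν : VolumeForm n M)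
    (e : OpenPartialHomeomorph M (EuclideanSpace ℝ (Fin n))) (y : EuclideanSpace ℝ (Fin n)) : ℝ :=
  |ν.toFun (e.symm y)
    (fun i => mfderiv (𝓡 n) (𝓡 n) e.symm y (EuclideanSpace.basisFun (Fin n) ℝ i))|

/-- The part of the measure of a volume form in the domain `U` of a chart `e`: the image under
`e⁻¹` of the measure `|ν(∂₁, …, ∂ₙ)| dy` on the coordinate domain `e(U)`. -/
def VolumeForm.chartMeasure [MeasurableSpace M] (ν : VolumeForm n M)
    (e : OpenPartialHomeomorph M (EuclideanSpace ℝ (Fin n))) : Measure M :=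
  Measure.map e.symm
    ((volume.restrict e.target).withDensity (fun y => ENNReal.ofReal (ν.chartDensity e y)))

/-- The measure of a volume form `ν`, which computes the integral `∫_M g ν` with respect to the
orientation of `M` given by `ν`. By the change of variables formula, any two of the measures
`ν.chartMeasure e` agree on the overlap of the two charts. On a second countable manifold their
supremum (the least measure that is at least each of them) is therefore the unique measure which
restricts to `ν.chartMeasure e` on the domain of every smooth chart `e`. -/
def VolumeForm.measure [MeasurableSpace M] (ν : VolumeForm n M) : Measure M :=
  ⨆ e ∈ IsManifold.maximalAtlas (𝓡 n) ∞ M, ν.chartMeasure e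

end PoissonManifold

end

noncomputable section

namespace PoissonManifold

open Set Filter Topology

/-! ### Multilinear algebra and the divergence theorem on Euclidean space -/

section Euclidean

variable {n : ℕ}

local notation "𝔼" => EuclideanSpace ℝ (Fin n)
local notation "𝐞" => EuclideanSpace.basisFun (Fin n) ℝ

/-! The integrand `J(df, dh)` is the derivative of `h` along the Hamiltonian field `X = X_f`, and
`X` preserves `ν`, so the claim is the divergence theorem for a divergence-free field and a
compactly supported function. A finite partition of unity on the support of `h` reduces it to `h`
supported in one chart. There, with `ρ = ν(∂₁, …, ∂ₙ)`, the condition `L_X ν = 0` reads `X(ρ) + ρ ∑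
∂ᵢXⁱ = 0`, that is `∑ ∂ᵢ(ρ Xⁱ) = 0` (`IsDivergence.coordinate_eq_zero`). Hence `|ρ| X(φ) = ∑ ∂ᵢ(φ
|ρ| Xⁱ)`, where `φ` is the coordinate expression of `h`, and each term is the derivative of a
compactly supported function, with integral zero (`integral_abs_mul_fderiv_eq_zero`). The passage to
`ν.measure`, a supremum of chart measures, rests on the change of variables formula: chart measures
agree on overlaps, so the supremum restricts to each of them (`VolumeForm.restrict_measure`). -/

theorem alternatingMap_comp_linearMap_basis (η : 𝔼 [⋀^Fin n]→ₗ[ℝ] ℝ) (A : 𝔼 →ₗ[ℝ] 𝔼) :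
    η (fun i => A (𝐞 i)) = LinearMap.det A * η (fun i => 𝐞 i) := by
  have h := η.eq_smul_basis_det (𝐞).toBasis
  have h1 : (𝐞).toBasis.det (fun i => A (𝐞 i)) = LinearMap.det A := by
    have := (𝐞).toBasis.det_comp A (𝐞).toBasis
    rw [(𝐞).toBasis.det_self, mul_one] at this
    rw [← this]
    congr 1
  conv_lhs => rw [h]
  rw [AlternatingMap.smul_apply, h1, smul_eq_mul, mul_comm, OrthonormalBasis.coe_toBasis]

/-- Expanding `v` in the basis, every term except the `i`-th repeats a basis vector. Summed over
`i`, this turns the bracket terms of the Lie derivative into a trace. -/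
theorem alternatingMap_update_basis (η : 𝔼 [⋀^Fin n]→ₗ[ℝ] ℝ) (i : Fin n) (v : 𝔼) :
    η (Function.update (fun j => 𝐞 j) i v) = v i * η (fun j => 𝐞 j) := by
  have hv : v = ∑ k, v k • 𝐞 k := by
    simpa using ((𝐞).sum_repr v).symm
  conv_lhs => rw [hv]
  rw [η.map_update_sum, Finset.sum_eq_single i]
  · rw [η.map_update_smul, smul_eq_mul, Function.update_eq_self i (fun j => 𝐞 j)]
  · intro k _ hk
    rw [η.map_update_smul, η.map_update_self (fun j => 𝐞 j) (i := i) (j := k) hk.symm, smul_zero]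
  · simp

/-- Integration by parts against the constant function 1; only the products with `F` and its
derivative need to be integrable. -/
theorem integral_fderiv_eq_zero_of_hasCompactSupport {F : 𝔼 → ℝ} (hF : ContDiff ℝ 1 F)
    (hc : HasCompactSupport F) (v : 𝔼) : ∫ y, fderiv ℝ F y v = 0 := by
  have hF' : Continuous fun y => fderiv ℝ F y v :=
    (hF.continuous_fderiv one_ne_zero).clm_apply continuous_const
  have h := integral_mul_fderiv_eq_neg_fderiv_mul_of_integrable (μ := (volume : Measure 𝔼))
    (f := F) (g := fun _ => (1 : ℝ)) (v := v) (by
      simpa using hF'.integrable_of_hasCompactSupport (hc.fderiv_apply ℝ v)) (by simp)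
    (by simpa using hF.continuous.integrable_of_hasCompactSupport hc)
    (fun x _ => hF.differentiable one_ne_zero x) (fun x _ => by fun_prop)
  simpa using h

/-- The sign of `ρ` is locally constant, so `|ρ|` inherits the smoothness of `ρ` and satisfies the
same linear divergence equation. -/
theorem eventuallyEq_abs_of_ne_zero {X : Type*} [TopologicalSpace X] {ρ : X → ℝ} {y : X}
    (hρ : ContinuousAt ρ y) (h0 : ρ y ≠ 0) :
    (fun z => |ρ z|) =ᶠ[𝓝 y] fun z => (SignType.sign (ρ y) : ℝ) * ρ z := by
  rcases h0.lt_or_gt with h | h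
  · filter_upwards [hρ.eventually_lt_const h] with z hz
    simp [abs_of_neg hz, h]
  · filter_upwards [hρ.eventually_const_lt h] with z hz
    simp [abs_of_pos hz, h]

/-- If the vector field `X` has zero divergence with respect to the density `ρ` on an open
set `U`, then the derivative along `X` of a compactly supported function integrates to zero. -/
theorem integral_abs_mul_fderiv_eq_zero {U : Set 𝔼} (hU : IsOpen U) {ρ : 𝔼 → ℝ} {X : 𝔼 → 𝔼}
    {φ : 𝔼 → ℝ} (hρ : ContDiffOn ℝ 1 ρ U) (hρ0 : ∀ y ∈ U, ρ y ≠ 0) (hX : ContDiffOn ℝ 1 X U)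
    (hdiv : ∀ y ∈ U, fderiv ℝ ρ y (X y) + ρ y * ∑ i, (fderiv ℝ X y (𝐞 i)) i = 0)
    (hφ : ContDiff ℝ 1 φ) (hc : HasCompactSupport φ) (hφU : tsupport φ ⊆ U) :
    Integrable (fun y => |ρ y| * fderiv ℝ φ y (X y)) ∧
      ∫ y, |ρ y| * fderiv ℝ φ y (X y) = 0 := by
  have hdρ : ∀ y ∈ U, DifferentiableAt ℝ ρ y := fun y hy =>
    (hρ.differentiableOn one_ne_zero).differentiableAt (hU.mem_nhds hy)
  have hdX : ∀ y ∈ U, DifferentiableAt ℝ X y := fun y hy =>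
    (hX.differentiableOn one_ne_zero).differentiableAt (hU.mem_nhds hy)
  have hdφ : ∀ y, DifferentiableAt ℝ φ y := hφ.differentiable one_ne_zero
  have habs : ∀ y ∈ U, (fun z => |ρ z|) =ᶠ[𝓝 y] fun z => (SignType.sign (ρ y) : ℝ) * ρ z :=
    fun y hy => eventuallyEq_abs_of_ne_zero (hdρ y hy).continuousAt (hρ0 y hy)
  have hcabs : ∀ y ∈ U, ContDiffAt ℝ 1 (fun z => |ρ z|) y := fun y hy =>
    (contDiffAt_const.mul (hρ.contDiffAt (hU.mem_nhds hy))).congr_of_eventuallyEq (habs y hy)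
  have hcX : ∀ i, ∀ y ∈ U, ContDiffAt ℝ 1 (fun z => X z i) y := fun i y hy =>
    (contDiffAt_piLp 2).1 (hX.contDiffAt (hU.mem_nhds hy)) i
  set F : Fin n → 𝔼 → ℝ := fun i y => φ y * (|ρ y| * X y i) with hFdef
  have hsupp : ∀ i, tsupport (F i) ⊆ tsupport φ := fun i => tsupport_mul_subset_left
  -- `ρ` and `X` are controlled only on `U`, but smoothness needs checking only on the support of `F
  -- i`, which lies in `U`.
  have hF : ∀ i, ContDiff ℝ 1 (F i) := fun i =>
    contMDiff_iff_contDiff.1 <| contMDiff_of_tsupport fun y hy =>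
      have hy' := hφU (hsupp i hy)
      (hφ.contDiffAt.mul ((hcabs y hy').mul (hcX i y hy'))).contMDiffAt
  have hFc : ∀ i, HasCompactSupport (F i) := fun i => hc.mul_right
  have hsum : (fun y => |ρ y| * fderiv ℝ φ y (X y)) = fun y => ∑ i, fderiv ℝ (F i) y (𝐞 i) := by
    funext y
    by_cases hy : y ∈ tsupport φ
    · have hyU := hφU hy
      obtain ⟨s, hs⟩ : ∃ s : ℝ, (fun z => |ρ z|) =ᶠ[𝓝 y] fun z => s * ρ z := ⟨_, habs y hyU⟩
      have hFe : ∀ i, F i =ᶠ[𝓝 y] fun z => φ z * (s * ρ z * X z i) := fun i => by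
        filter_upwards [hs] with z hz
        simp only [hFdef, hz]
      have hXi : ∀ i, HasFDerivAt (fun z => X z i)
          ((EuclideanSpace.proj i).comp (fderiv ℝ X y)) y := fun i =>
        (EuclideanSpace.proj i : 𝔼 →L[ℝ] ℝ).hasFDerivAt.comp y (hdX y hyU).hasFDerivAt
      have hFi : ∀ i, fderiv ℝ (F i) y (𝐞 i) = φ y * (s * ρ y * (fderiv ℝ X y (𝐞 i)) i
          + X y i * (s * fderiv ℝ ρ y (𝐞 i))) + (s * ρ y * X y i) * fderiv ℝ φ y (𝐞 i) := by
        intro i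
        have h := (hdφ y).hasFDerivAt.mul (((hdρ y hyU).hasFDerivAt.const_mul s).mul (hXi i))
        rw [(h.congr_of_eventuallyEq (hFe i)).fderiv]
        simp
        ring
      have hexp : ∀ L : 𝔼 →L[ℝ] ℝ, L (X y) = ∑ i, X y i * L (𝐞 i) := fun L => by
        have hv : X y = ∑ k, X y k • 𝐞 k := by simpa using ((𝐞).sum_repr (X y)).symm
        conv_lhs => rw [hv]
        rw [map_sum]
        simp only [map_smul, smul_eq_mul]
      have h0 := hdiv y hyU
      simp only [hFi]
      rw [hexp] at h0 ⊢
      have hsy : |ρ y| = s * ρ y := hs.self_of_nhds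
      rw [hsy]
      -- Product rule, grouped so that the factor of `φ y * s` is the left side of the divergence
      -- equation.
      have : ∑ i, (φ y * (s * ρ y * (fderiv ℝ X y (𝐞 i)) i
          + X y i * (s * fderiv ℝ ρ y (𝐞 i))) + (s * ρ y * X y i) * fderiv ℝ φ y (𝐞 i))
          = φ y * s * (∑ i, X y i * fderiv ℝ ρ y (𝐞 i) + ρ y * ∑ i, (fderiv ℝ X y (𝐞 i)) i)
            + s * ρ y * ∑ i, X y i * fderiv ℝ φ y (𝐞 i) := by
        simp only [Finset.mul_sum, ← Finset.sum_add_distrib]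
        refine Finset.sum_congr rfl fun i _ => ?_
        ring
      rw [this, h0, mul_zero, zero_add]
    · have h1 : fderiv ℝ φ y = 0 :=
        image_eq_zero_of_notMem_tsupport fun h => hy (tsupport_fderiv_subset ℝ h)
      have h2 : ∀ i, fderiv ℝ (F i) y = 0 := fun i =>
        image_eq_zero_of_notMem_tsupport fun h => hy (hsupp i (tsupport_fderiv_subset ℝ h))
      simp [h1, h2]
  have hint : ∀ i, Integrable (fun y => fderiv ℝ (F i) y (𝐞 i)) := fun i =>
    (((hF i).continuous_fderiv one_ne_zero).clm_apply
      continuous_const).integrable_of_hasCompactSupport ((hFc i).fderiv_apply ℝ _)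
  rw [hsum]
  refine ⟨integrable_finsetSum _ fun i _ => hint i, ?_⟩
  rw [integral_finsetSum _ fun i _ => hint i]
  exact Finset.sum_eq_zero fun i _ => integral_fderiv_eq_zero_of_hasCompactSupport (hF i) (hFc i) _

end Euclidean

/-! ### Vector fields, volume forms and divergence in a chart -/

section Chart

variable {n : ℕ} {M : Type*} [TopologicalSpace M] [ChartedSpace (EuclideanSpace ℝ (Fin n)) M]
  {e : OpenPartialHomeomorph M (EuclideanSpace ℝ (Fin n))}

local notation "𝔼" => EuclideanSpace ℝ (Fin n)
local notation "𝐞" => EuclideanSpace.basisFun (Fin n) ℝ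

theorem mdifferentiable_of_mem_maximalAtlas (he : e ∈ IsManifold.maximalAtlas (𝓡 n) ∞ M) :
    e.MDifferentiable (𝓡 n) (𝓡 n) :=
  ⟨(contMDiffOn_of_mem_maximalAtlas he).mdifferentiableOn (by simp),
    (contMDiffOn_symm_of_mem_maximalAtlas he).mdifferentiableOn (by simp)⟩

/-- The coordinate function `ν(∂₁, …, ∂ₙ)` of a volume form in a chart. -/
def VolumeForm.coordinate (ν : VolumeForm n M) (e : OpenPartialHomeomorph M 𝔼) (y : 𝔼) : ℝ :=
  ν.toFun (e.symm y) (fun i => mfderiv (𝓡 n) (𝓡 n) e.symm y (𝐞 i))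

/-- The expression of a vector field in the coordinates of a chart. -/
def coordinateField (X : ∀ x : M, TangentSpace (𝓡 n) x) (e : OpenPartialHomeomorph M 𝔼)
    (y : 𝔼) : 𝔼 :=
  mfderiv (𝓡 n) (𝓡 n) e (e.symm y) (X (e.symm y))

theorem mfderiv_symm_mfderiv_apply (he : e ∈ IsManifold.maximalAtlas (𝓡 n) ∞ M) {x : M}
    (hx : x ∈ e.source) (v : TangentSpace (𝓡 n) x) :
    mfderiv (𝓡 n) (𝓡 n) e.symm (e x) (mfderiv (𝓡 n) (𝓡 n) e x v) = v :=
  DFunLike.congr_fun ((mdifferentiable_of_mem_maximalAtlas he).symm_comp_deriv hx) v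

theorem mfderiv_mfderiv_symm_apply (he : e ∈ IsManifold.maximalAtlas (𝓡 n) ∞ M) {y : 𝔼}
    (hy : y ∈ e.target) (v : 𝔼) :
    mfderiv (𝓡 n) (𝓡 n) e (e.symm y) (mfderiv (𝓡 n) (𝓡 n) e.symm y v) = v :=
  DFunLike.congr_fun ((mdifferentiable_of_mem_maximalAtlas he).comp_symm_deriv hy) v

theorem isInvertible_mfderiv (he : e ∈ IsManifold.maximalAtlas (𝓡 n) ∞ M) {x : M}
    (hx : x ∈ e.source) : (mfderiv (𝓡 n) (𝓡 n) e x).IsInvertible :=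
  ⟨(mdifferentiable_of_mem_maximalAtlas he).mfderiv hx, rfl⟩

/-- `mpullback` uses the inverse of the derivative of `e`, which on the chart domain is the
derivative of `e.symm`. This makes the general results on pullbacks available for `chartPullback`.
-/
theorem mpullback_chart_apply (he : e ∈ IsManifold.maximalAtlas (𝓡 n) ∞ M) {x : M}
    (hx : x ∈ e.source) (V : ∀ y : 𝔼, TangentSpace (𝓡 n) y) :
    VectorField.mpullback (𝓡 n) (𝓡 n) e V x = mfderiv (𝓡 n) (𝓡 n) e.symm (e x) (V (e x)) := by
  obtain ⟨A, hA⟩ := isInvertible_mfderiv he hx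
  rw [VectorField.mpullback_apply, ← hA, ContinuousLinearMap.inverse_equiv]
  apply A.injective
  rw [ContinuousLinearEquiv.coe_coe, A.apply_symm_apply]
  have h := mfderiv_mfderiv_symm_apply he (e.map_source hx) (V (e x))
  rw [e.left_inv hx, ← hA] at h
  exact h.symm

/-- The vector field on a chart domain with the given coordinate expression. -/
def chartPullback (e : OpenPartialHomeomorph M 𝔼) (V : 𝔼 → 𝔼) (x : M) : TangentSpace (𝓡 n) x :=
  mfderiv (𝓡 n) (𝓡 n) e.symm (e x) (V (e x))

theorem chartPullback_coordinateField (he : e ∈ IsManifold.maximalAtlas (𝓡 n) ∞ M) {x : M}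
    (hx : x ∈ e.source) (X : ∀ x : M, TangentSpace (𝓡 n) x) :
    chartPullback e (coordinateField X e) x = X x := by
  rw [chartPullback, coordinateField, e.left_inv hx]
  exact mfderiv_symm_mfderiv_apply he hx (X x)

theorem chartPullback_symm {y : 𝔼} (hy : y ∈ e.target) (V : 𝔼 → 𝔼) :
    chartPullback e V (e.symm y) = mfderiv (𝓡 n) (𝓡 n) e.symm y (V y) := by
  rw [chartPullback, e.right_inv hy]

theorem chartPullback_eventuallyEq_mpullback (he : e ∈ IsManifold.maximalAtlas (𝓡 n) ∞ M) {x : M}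
    (hx : x ∈ e.source) (V : ∀ y : 𝔼, TangentSpace (𝓡 n) y) :
    chartPullback e V =ᶠ[𝓝 x] VectorField.mpullback (𝓡 n) (𝓡 n) e V := by
  filter_upwards [e.open_source.mem_nhds hx] with z hz
  exact (mpullback_chart_apply he hz V).symm

theorem contMDiffAt_chartPullback [IsManifold (𝓡 n) ∞ M]
    (he : e ∈ IsManifold.maximalAtlas (𝓡 n) ∞ M) {x : M} (hx : x ∈ e.source) {V : 𝔼 → 𝔼}
    (hV : ContDiffAt ℝ ∞ V (e x)) :
    ContMDiffAt (𝓡 n) (𝓡 n).tangent ∞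
      (fun z => (⟨z, chartPullback e V z⟩ : TangentBundle (𝓡 n) M)) x := by
  have hV' : ContMDiffAt (𝓡 n) (𝓡 n).tangent ∞
      (fun z => (⟨z, V z⟩ : TangentBundle (𝓡 n) 𝔼)) (e x) :=
    contMDiffAt_vectorSpace_iff_contDiffAt.2 hV
  refine (ContMDiffAt.mpullback_vectorField_preimage (n := ∞) hV'
    (contMDiffAt_of_mem_maximalAtlas he hx) (isInvertible_mfderiv he hx)
    (by simp)).congr_of_eventuallyEq ?_
  filter_upwards [chartPullback_eventuallyEq_mpullback he hx V] with z hz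
  exact congrArg (Bundle.TotalSpace.mk z) hz

/-- Naturality of the Lie bracket under pullback, together with the fact that the manifold bracket
on the model space is the ordinary one. -/
theorem mlieBracket_chartPullback [IsManifold (𝓡 n) ∞ M]
    (he : e ∈ IsManifold.maximalAtlas (𝓡 n) ∞ M) {x : M} (hx : x ∈ e.source) {V W : 𝔼 → 𝔼}
    (hV : ContDiffAt ℝ ∞ V (e x)) (hW : ContDiffAt ℝ ∞ W (e x)) :
    VectorField.mlieBracket (𝓡 n) (chartPullback e V) (chartPullback e W) x
      = chartPullback e (VectorField.lieBracket ℝ V W) x := by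
  have : IsManifold (𝓡 n) (minSmoothness ℝ 3) M := .of_le (n := ∞) (by
    simpa using ENat.LEInfty.out)
  have hV' : ContMDiffAt (𝓡 n) (𝓡 n).tangent ∞
      (fun z => (⟨z, V z⟩ : TangentBundle (𝓡 n) 𝔼)) (e x) :=
    contMDiffAt_vectorSpace_iff_contDiffAt.2 hV
  have hW' : ContMDiffAt (𝓡 n) (𝓡 n).tangent ∞
      (fun z => (⟨z, W z⟩ : TangentBundle (𝓡 n) 𝔼)) (e x) :=
    contMDiffAt_vectorSpace_iff_contDiffAt.2 hW
  rw [(chartPullback_eventuallyEq_mpullback he hx V).mlieBracket_vectorField_eq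
    (chartPullback_eventuallyEq_mpullback he hx W)]
  refine (VectorField.mpullback_mlieBracket (n := ∞) (hV'.mdifferentiableAt (by simp))
    (hW'.mdifferentiableAt (by simp)) (contMDiffAt_of_mem_maximalAtlas he hx)
    (by simpa using ENat.LEInfty.out)).symm.trans
    ((mpullback_chart_apply he hx _).trans ?_)
  refine congrArg (mfderiv (𝓡 n) (𝓡 n) e.symm (e x)) ?_
  have h : ∀ V W : ∀ y : 𝔼, TangentSpace (𝓡 n) y, VectorField.mlieBracket (𝓡 n) V W (e x)
      = VectorField.lieBracket ℝ (E := 𝔼) V W (e x) := fun V W => by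
    rw [← VectorField.mlieBracketWithin_univ, VectorField.mlieBracketWithin_eq_lieBracketWithin]
    exact congrFun VectorField.lieBracketWithin_univ (e x)
  exact h V W

theorem coordinateField_apply (X : ∀ x : M, TangentSpace (𝓡 n) x) {x : M} (hx : x ∈ e.source) :
    coordinateField X e (e x) = mfderiv (𝓡 n) (𝓡 n) e x (X x) := by
  rw [coordinateField, e.left_inv hx]

theorem VolumeForm.contDiffOn_coordinate (ν : VolumeForm n M)
    (he : e ∈ IsManifold.maximalAtlas (𝓡 n) ∞ M) : ContDiffOn ℝ ∞ (ν.coordinate e) e.target :=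
  ν.smooth e he fun i => 𝐞 i

/-- The alternating form on the model space given by a volume form in a chart at a point. -/
def VolumeForm.coordinateForm (ν : VolumeForm n M) (e : OpenPartialHomeomorph M 𝔼) (y : 𝔼) :
    𝔼 [⋀^Fin n]→ₗ[ℝ] ℝ :=
  (ν.toFun (e.symm y)).toAlternatingMap.compLinearMap
    (mfderiv (𝓡 n) (𝓡 n) e.symm y).toLinearMap

theorem VolumeForm.coordinateForm_apply (ν : VolumeForm n M) (y : 𝔼) (v : Fin n → 𝔼) :
    ν.coordinateForm e y v =
      ν.toFun (e.symm y) (fun i => mfderiv (𝓡 n) (𝓡 n) e.symm y (v i)) := rfl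

/-- A top-degree form that vanishes on a basis is zero; as the derivative of the chart is
invertible, `ν` itself would then vanish at the point. -/
theorem VolumeForm.coordinate_ne_zero (ν : VolumeForm n M)
    (he : e ∈ IsManifold.maximalAtlas (𝓡 n) ∞ M) {y : 𝔼} (hy : y ∈ e.target) :
    ν.coordinate e y ≠ 0 := by
  intro h
  have h0 : ν.coordinateForm e y = 0 := by
    rw [(ν.coordinateForm e y).eq_smul_basis_det (𝐞).toBasis, OrthonormalBasis.coe_toBasis,
      ν.coordinateForm_apply]
    exact (congrArg (· • (𝐞).toBasis.det) h).trans (zero_smul _ _)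
  refine ν.nonvanishing (e.symm y) (ContinuousAlternatingMap.ext fun v => ?_)
  have h1 := ν.coordinateForm_apply (e := e) y
    (fun i => mfderiv (𝓡 n) (𝓡 n) e (e.symm y) (v i))
  rw [h0] at h1
  refine Eq.trans (congrArg _ (funext fun i => ?_)) h1.symm
  have := mfderiv_symm_mfderiv_apply he (e.map_target hy) (v i)
  rw [e.right_inv hy] at this
  exact this.symm

/-- Chain rule for `f = (f ∘ e.symm) ∘ e` near `x`. Differentiability is asked of the coordinate
expression because that is what the smoothness of `ν` provides for `ν(Y₁, …, Yₙ)`. -/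
theorem mvfderiv_eq_fderiv_comp (he : e ∈ IsManifold.maximalAtlas (𝓡 n) ∞ M) {x : M}
    (hx : x ∈ e.source) {f : M → ℝ} (hf : DifferentiableAt ℝ (f ∘ e.symm) (e x))
    (v : TangentSpace (𝓡 n) x) :
    mvfderiv (𝓡 n) f x v = fderiv ℝ (f ∘ e.symm) (e x) (mfderiv (𝓡 n) (𝓡 n) e x v) := by
  have h1 : f =ᶠ[𝓝 x] (f ∘ e.symm) ∘ e := by
    filter_upwards [e.open_source.mem_nhds hx] with z hz
    simp [e.left_inv hz]
  have h2 : mfderiv (𝓡 n) 𝓘(ℝ, ℝ) f x = mfderiv (𝓡 n) 𝓘(ℝ, ℝ) ((f ∘ e.symm) ∘ e) x :=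
    h1.mfderiv_eq
  have h3 := mfderiv_comp x (I := 𝓡 n) (I' := 𝓡 n) (I'' := 𝓘(ℝ, ℝ)) hf.mdifferentiableAt
    ((mdifferentiable_of_mem_maximalAtlas he).mdifferentiableAt hx)
  rw [← mfderiv_eq_fderiv]
  exact DFunLike.congr_fun (h2.trans h3) v

theorem contDiffOn_comp_symm (he : e ∈ IsManifold.maximalAtlas (𝓡 n) ∞ M) {f : M → ℝ}
    (hf : ContMDiff (𝓡 n) 𝓘(ℝ, ℝ) ∞ f) : ContDiffOn ℝ ∞ (f ∘ e.symm) e.target :=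
  contMDiffOn_iff_contDiffOn.1 (hf.comp_contMDiffOn (contMDiffOn_symm_of_mem_maximalAtlas he))

/-- Around each point of a chart domain, a coordinate vector field agrees with a global smooth
vector field. -/
theorem exists_smooth_section_eventuallyEq [T2Space M] [IsManifold (𝓡 n) ∞ M]
    (he : e ∈ IsManifold.maximalAtlas (𝓡 n) ∞ M) {x : M} (hx : x ∈ e.source) (v : 𝔼) :
    ∃ Y : Cₛ^∞⟮𝓡 n; EuclideanSpace ℝ (Fin n), (TangentSpace (𝓡 n) : M → Type _)⟯,
      ∀ᶠ z in 𝓝 x, Y z = chartPullback e (fun _ => v) z := by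
  obtain ⟨ψ, hψ⟩ : ∃ ψ : SmoothBumpFunction (𝓡 n) x, tsupport ψ ⊆ e.source := by
    obtain ⟨ψ, -, h⟩ := (SmoothBumpFunction.nhds_basis_tsupport (I := 𝓡 n) x).mem_iff.1
      (e.open_source.mem_nhds hx)
    exact ⟨ψ, h⟩
  refine ⟨⟨(ψ : M → ℝ) • chartPullback e (fun _ => v),
    ContMDiffOn.smul_section_of_tsupport ψ.contMDiff.contMDiffOn e.open_source hψ fun z hz =>
      (contMDiffAt_chartPullback he hz contDiffAt_const).contMDiffWithinAt⟩, ?_⟩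
  filter_upwards [ψ.eventuallyEq_one] with z hz
  change ψ z • chartPullback e (fun _ => v) z = _
  rw [hz, Pi.one_apply, one_smul]

/-- The coordinate expression of the vanishing of the divergence. -/
theorem IsDivergence.coordinate_eq_zero [T2Space M] [IsManifold (𝓡 n) ∞ M] {ν : VolumeForm n M}
    {X : ∀ x : M, TangentSpace (𝓡 n) x} (hX : IsDivergence ν X 0)
    (he : e ∈ IsManifold.maximalAtlas (𝓡 n) ∞ M)
    (hXe : ContDiffOn ℝ ∞ (coordinateField X e) e.target) {y : 𝔼} (hy : y ∈ e.target) :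
    fderiv ℝ (ν.coordinate e) y (coordinateField X e y)
      + ν.coordinate e y * ∑ i, (fderiv ℝ (coordinateField X e) y (𝐞 i)) i = 0 := by
  obtain ⟨x, hx, rfl⟩ : ∃ x ∈ e.source, e x = y := ⟨e.symm y, e.map_target hy, e.right_inv hy⟩
  -- `IsDivergence` tests only global smooth fields, so the coordinate fields are replaced by global
  -- fields that agree with them near `x`; derivatives and brackets at `x` do not see the
  -- difference.
  choose Y hY using fun i => exists_smooth_section_eventuallyEq he hx (𝐞 i)
  have h := hX Y x
  rw [Pi.zero_apply, zero_mul, lieDerivative] at h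
  have hYs : ∀ᶠ z in 𝓝 (e x), ∀ i,
      Y i (e.symm z) = mfderiv (𝓡 n) (𝓡 n) e.symm z (𝐞 i) := by
    have hc : Tendsto e.symm (𝓝 (e x)) (𝓝 x) := by
      simpa only [ContinuousAt, e.left_inv hx] using e.symm.continuousAt hy
    filter_upwards [hc.eventually (eventually_all.2 hY), e.open_target.mem_nhds hy] with z hz hzt i
    rw [hz i, chartPullback_symm hzt]
  have hρ : (fun z => ν.toFun z (fun i => Y i z)) ∘ e.symm =ᶠ[𝓝 (e x)] ν.coordinate e := by
    filter_upwards [hYs] with z hz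
    simp only [Function.comp_apply, VolumeForm.coordinate, hz]
  have hdρ : DifferentiableAt ℝ (ν.coordinate e) (e x) :=
    ((ν.contDiffOn_coordinate he).differentiableOn (by simp)).differentiableAt
      (e.open_target.mem_nhds hy)
  have hdX : DifferentiableAt ℝ (coordinateField X e) (e x) :=
    (hXe.differentiableOn (by simp)).differentiableAt (e.open_target.mem_nhds hy)
  have hfirst : mvfderiv (𝓡 n) (fun z => ν.toFun z (fun i => Y i z)) x (X x)
      = fderiv ℝ (ν.coordinate e) (e x) (coordinateField X e (e x)) := by
    rw [mvfderiv_eq_fderiv_comp he hx (hdρ.congr_of_eventuallyEq hρ), hρ.fderiv_eq,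
      coordinateField_apply X hx]
  -- In coordinates the second field is the constant `𝐞 i`, so only the term `-∂ᵢX` of the bracket
  -- survives.
  have hbr : ∀ i, VectorField.mlieBracket (𝓡 n) X (Y i) x
      = mfderiv (𝓡 n) (𝓡 n) e.symm (e x) (-(fderiv ℝ (coordinateField X e) (e x) (𝐞 i))) := by
    intro i
    have hXx : X =ᶠ[𝓝 x] chartPullback e (coordinateField X e) := by
      filter_upwards [e.open_source.mem_nhds hx] with z hz
      rw [chartPullback_coordinateField he hz]
    rw [hXx.mlieBracket_vectorField_eq (hY i), mlieBracket_chartPullback he hx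
      (hXe.contDiffAt (e.open_target.mem_nhds hy)) contDiffAt_const, chartPullback]
    refine congrArg (mfderiv (𝓡 n) (𝓡 n) e.symm (e x)) ?_
    rw [VectorField.lieBracket, fderiv_fun_const]
    exact zero_sub _
  have hsecond : ∀ i, ν.toFun x (Function.update (fun j => Y j x) i
      (VectorField.mlieBracket (𝓡 n) X (Y i) x))
      = -((fderiv ℝ (coordinateField X e) (e x) (𝐞 i)) i * ν.coordinate e (e x)) := by
    intro i
    have h1 := alternatingMap_update_basis (ν.coordinateForm e (e x)) i
      (-(fderiv ℝ (coordinateField X e) (e x) (𝐞 i)))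
    rw [ν.coordinateForm_apply, ν.coordinateForm_apply] at h1
    change _ = _ * ν.coordinate e (e x) at h1
    rw [PiLp.neg_apply, neg_mul, e.left_inv hx] at h1
    rw [← h1, hbr]
    congr 1
    funext j
    by_cases hj : j = i
    · subst hj
      exact (Function.update_self ..).trans
        (congrArg (mfderiv (𝓡 n) (𝓡 n) e.symm (e x)) (Function.update_self j _ (fun j => 𝐞 j)).symm)
    · have := hYs.self_of_nhds j
      rw [e.left_inv hx] at this
      exact (Function.update_of_ne hj _ _).trans (this.trans
        (congrArg (mfderiv (𝓡 n) (𝓡 n) e.symm (e x)) (Function.update_of_ne hj _ _).symm))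
  rw [hfirst, Finset.sum_congr rfl fun i _ => hsecond i] at h
  rw [← h, Finset.sum_neg_distrib, ← Finset.sum_mul]
  ring

/-- The derivative of `e.symm` factors as that of `e'.symm` after that of the transition map, and a
top-degree form scales by the determinant. This factor cancels the Jacobian in the change of
variables. -/
theorem VolumeForm.coordinate_eq_det_mul {e' : OpenPartialHomeomorph M 𝔼}
    (ν : VolumeForm n M) (he : e ∈ IsManifold.maximalAtlas (𝓡 n) ∞ M) (he' : e' ∈ IsManifold.maximalAtlas (𝓡 n) ∞ M)
    {y : 𝔼} (hy : y ∈ e.target) (hy' : e.symm y ∈ e'.source) :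
    ν.coordinate e y
      = (fderiv ℝ (e' ∘ e.symm) y).det * ν.coordinate e' (e' (e.symm y)) := by
  have hd := mfderiv_comp y ((mdifferentiable_of_mem_maximalAtlas he').mdifferentiableAt hy')
    ((mdifferentiable_of_mem_maximalAtlas he).mdifferentiableAt_symm hy)
  rw [mfderiv_eq_fderiv] at hd
  have h := alternatingMap_comp_linearMap_basis (ν.coordinateForm e' (e' (e.symm y)))
    (fderiv ℝ (e' ∘ e.symm) y).toLinearMap
  rw [ν.coordinateForm_apply, ν.coordinateForm_apply] at h
  refine Eq.trans ?_ h
  rw [e'.left_inv hy']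
  refine congrArg (ν.toFun (e.symm y)) (funext fun i => ?_)
  have h1 := mfderiv_symm_mfderiv_apply he' hy' (mfderiv (𝓡 n) (𝓡 n) e.symm y (𝐞 i))
  refine h1.symm.trans (congrArg (mfderiv (𝓡 n) (𝓡 n) e'.symm (e' (e.symm y))) ?_)
  exact (DFunLike.congr_fun hd (𝐞 i)).symm

theorem VolumeForm.chartDensity_eq_abs_coordinate (ν : VolumeForm n M) (y : 𝔼) :
    ν.chartDensity e y = |ν.coordinate e y| := rfl

end Chart

/-! ### The measure of a volume form on chart domains -/

section Measure

variable {n : ℕ} {M : Type*} [TopologicalSpace M] [ChartedSpace (EuclideanSpace ℝ (Fin n)) M]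
  [MeasurableSpace M] [BorelSpace M] {e e' : OpenPartialHomeomorph M (EuclideanSpace ℝ (Fin n))}

local notation "𝔼" => EuclideanSpace ℝ (Fin n)
local notation "𝐞" => EuclideanSpace.basisFun (Fin n) ℝ

theorem VolumeForm.aemeasurable_symm (ν : VolumeForm n M)
    (e : OpenPartialHomeomorph M (EuclideanSpace ℝ (Fin n))) :
    AEMeasurable e.symm ((volume.restrict e.target).withDensity
      (fun y => ENNReal.ofReal (ν.chartDensity e y))) :=
  (e.continuousOn_symm.aemeasurable e.open_target.measurableSet).mono_ac
    (withDensity_absolutelyContinuous _ _)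

theorem VolumeForm.chartMeasure_apply (ν : VolumeForm n M)
    (e : OpenPartialHomeomorph M (EuclideanSpace ℝ (Fin n))) {s : Set M} (hs : MeasurableSet s) :
    ν.chartMeasure e s = ∫⁻ y in e.target ∩ e.symm ⁻¹' s, ENNReal.ofReal (ν.chartDensity e y) := by
  rw [VolumeForm.chartMeasure, Measure.map_apply_of_aemeasurable (ν.aemeasurable_symm e) hs,
    withDensity_apply', Measure.restrict_restrict' e.open_target.measurableSet, inter_comm]

theorem VolumeForm.chartMeasure_compl_source (ν : VolumeForm n M)
    (e : OpenPartialHomeomorph M (EuclideanSpace ℝ (Fin n))) :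
    ν.chartMeasure e e.sourceᶜ = 0 := by
  rw [ν.chartMeasure_apply e e.open_source.measurableSet.compl]
  have : e.target ∩ e.symm ⁻¹' e.sourceᶜ = ∅ :=
    eq_empty_of_forall_notMem fun y hy => hy.2 (e.map_target hy.1)
  rw [this, Measure.restrict_empty, lintegral_zero_measure]

theorem VolumeForm.restrict_chartMeasure (ν : VolumeForm n M)
    (e : OpenPartialHomeomorph M (EuclideanSpace ℝ (Fin n))) :
    (ν.chartMeasure e).restrict e.source = ν.chartMeasure e :=
  Measure.restrict_eq_self_of_ae_mem (ν.chartMeasure_compl_source e)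

/-- Two chart measures of a volume form agree on the overlap of the charts. -/
theorem VolumeForm.chartMeasure_apply_eq (ν : VolumeForm n M)
    (he : e ∈ IsManifold.maximalAtlas (𝓡 n) ∞ M) (he' : e' ∈ IsManifold.maximalAtlas (𝓡 n) ∞ M)
    {s : Set M} (hs : MeasurableSet s) (hse : s ⊆ e.source) (hse' : s ⊆ e'.source) :
    ν.chartMeasure e s = ν.chartMeasure e' s := by
  set t : Set 𝔼 := e.target ∩ e.symm ⁻¹' s with ht
  have htm : MeasurableSet t := by
    have h1 : MeasurableSet (e.target.domRestrict e.symm ⁻¹' s) :=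
      (continuousOn_iff_continuous_domRestrict.1 e.continuousOn_symm).measurable hs
    have h2 := e.open_target.measurableSet.subtype_image h1
    convert h2 using 1
    ext y
    simp [ht, domRestrict_apply, and_comm]
  -- The transition map carries the coordinate image of `s` under `e` onto that under `e'`.
  have himage : e'.target ∩ e'.symm ⁻¹' s = (e' ∘ e.symm) '' t := by
    have h1 : e.symm '' t = s := by
      rw [ht, ← e.image_eq_target_inter_inv_preimage hse]
      exact e.toPartialEquiv.symm_image_image_of_subset_source hse
    rw [image_comp, h1, e'.image_eq_target_inter_inv_preimage hse']
  have hinj : InjOn (e' ∘ e.symm) t := fun y hy z hz h =>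
    e.symm.injOn hy.1 hz.1 (e'.injOn (hse' hy.2) (hse' hz.2) h)
  have hdiff : ∀ y ∈ t, HasFDerivWithinAt (e' ∘ e.symm) (fderiv ℝ (e' ∘ e.symm) y) t y := by
    intro y hy
    have := ((mdifferentiable_of_mem_maximalAtlas he').mdifferentiableAt (hse' hy.2)).comp y
      ((mdifferentiable_of_mem_maximalAtlas he).mdifferentiableAt_symm hy.1)
    exact this.differentiableAt.hasFDerivAt.hasFDerivWithinAt
  rw [ν.chartMeasure_apply e hs, ν.chartMeasure_apply e' hs, himage,
    lintegral_image_eq_lintegral_abs_det_fderiv_mul volume htm hdiff hinj]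
  refine setLIntegral_congr_fun htm fun y hy => ?_
  rw [← ENNReal.ofReal_mul (abs_nonneg _), ν.chartDensity_eq_abs_coordinate,
    ν.chartDensity_eq_abs_coordinate, ν.coordinate_eq_det_mul he he' hy.1 (hse' hy.2), abs_mul]
  rfl

/-- The measure of a volume form restricts to the chart measure on each chart domain. -/
theorem VolumeForm.restrict_measure (ν : VolumeForm n M)
    (he : e ∈ IsManifold.maximalAtlas (𝓡 n) ∞ M) :
    ν.measure.restrict e.source = ν.chartMeasure e := by
  have hem := e.open_source.measurableSet
  have hle : ν.chartMeasure e ≤ ν.measure :=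
    le_iSup₂ (f := fun e (_ : e ∈ IsManifold.maximalAtlas (𝓡 n) ∞ M) => ν.chartMeasure e) e he
  -- The right side bounds every chart measure: inside `e.source` the measure of `e'` agrees with
  -- that of `e` on the overlap, and outside it is at most `ν.measure`. It therefore bounds the
  -- supremum, and restriction to `e.source` removes its second term.
  have hadd : ν.measure ≤ ν.chartMeasure e + ν.measure.restrict e.sourceᶜ := by
    refine iSup₂_le fun e' he' => Measure.le_iff.2 fun s hs => ?_
    have hle' : ν.chartMeasure e' ≤ ν.measure :=
      le_iSup₂ (f := fun e (_ : e ∈ IsManifold.maximalAtlas (𝓡 n) ∞ M) => ν.chartMeasure e) e' he'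
    rw [Measure.add_apply, Measure.restrict_apply hs, ← measure_inter_add_sdiff s hem]
    refine add_le_add ?_ (hle' _)
    rw [← ν.restrict_chartMeasure e', Measure.restrict_apply (hs.inter hem),
      ← ν.chartMeasure_apply_eq he he' ((hs.inter hem).inter e'.open_source.measurableSet)
        (fun x hx => hx.1.2) (fun x hx => hx.2)]
    exact measure_mono fun x hx => hx.1.1
  refine le_antisymm ?_ ?_
  · refine (Measure.restrict_mono_measure hadd e.source).trans ?_
    rw [Measure.restrict_add, Measure.restrict_restrict hem, inter_compl_self,
      Measure.restrict_empty, add_zero]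
    exact Measure.restrict_le_self
  · rw [← ν.restrict_chartMeasure e]
    exact Measure.restrict_mono_measure hle _

end Measure

/-! ### Hamiltonian fields in coordinates and the case of support in one chart -/

section Poisson

variable {n : ℕ} {M : Type*} [TopologicalSpace M] [ChartedSpace (EuclideanSpace ℝ (Fin n)) M]
  {e : OpenPartialHomeomorph M (EuclideanSpace ℝ (Fin n))}

local notation "𝔼" => EuclideanSpace ℝ (Fin n)
local notation "𝐞" => EuclideanSpace.basisFun (Fin n) ℝ

theorem PoissonTensor.apply_hamiltonianVectorField (J : PoissonTensor n M) (f : M → ℝ) (x : M)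
    (β : Cotangent (n := n) x) :
    β (J.hamiltonianVectorField f x) = J.toFun x (differential f x) β :=
  Module.apply_evalEquiv_symm_apply ℝ (TangentSpace (𝓡 n) x) β _

/-- The differential of a function along the Hamiltonian vector field, in a chart. -/
theorem PoissonTensor.bracket_eq_fderiv (J : PoissonTensor n M)
    (he : e ∈ IsManifold.maximalAtlas (𝓡 n) ∞ M) (f : M → ℝ) {h : M → ℝ}
    (hh : ContMDiff (𝓡 n) 𝓘(ℝ, ℝ) ∞ h) {y : 𝔼} (hy : y ∈ e.target) :
    bracket J.toFun f h (e.symm y)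
      = fderiv ℝ (h ∘ e.symm) y (coordinateField (J.hamiltonianVectorField f) e y) := by
  have hd : DifferentiableAt ℝ (h ∘ e.symm) (e (e.symm y)) := by
    rw [e.right_inv hy]
    exact ((contDiffOn_comp_symm he hh).differentiableOn (by simp)).differentiableAt
      (e.open_target.mem_nhds hy)
  have h1 := mvfderiv_eq_fderiv_comp he (e.map_target hy) hd
    (J.hamiltonianVectorField f (e.symm y))
  rw [e.right_inv hy] at h1
  rw [bracket, ← J.apply_hamiltonianVectorField]
  exact h1

theorem differential_eq_sum (he : e ∈ IsManifold.maximalAtlas (𝓡 n) ∞ M) {f : M → ℝ}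
    (hf : ContMDiff (𝓡 n) 𝓘(ℝ, ℝ) ∞ f) {y : 𝔼} (hy : y ∈ e.target) :
    differential f (e.symm y) = ∑ j, fderiv ℝ (f ∘ e.symm) y (𝐞 j) •
      ((EuclideanSpace.proj j : 𝔼 →L[ℝ] ℝ).toLinearMap ∘ₗ
        (mfderiv (𝓡 n) (𝓡 n) e (e.symm y)).toLinearMap) := by
  have hd : DifferentiableAt ℝ (f ∘ e.symm) (e (e.symm y)) := by
    rw [e.right_inv hy]
    exact ((contDiffOn_comp_symm he hf).differentiableOn (by simp)).differentiableAt
      (e.open_target.mem_nhds hy)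
  refine LinearMap.ext fun v => ?_
  have h1 := mvfderiv_eq_fderiv_comp he (e.map_target hy) hd v
  rw [e.right_inv hy] at h1
  refine h1.trans ?_
  rw [LinearMap.sum_apply]
  obtain ⟨w, hw⟩ : ∃ w : 𝔼, w = mfderiv (𝓡 n) (𝓡 n) e (e.symm y) v := ⟨_, rfl⟩
  have h2 : fderiv ℝ (f ∘ e.symm) y w = ∑ j, fderiv ℝ (f ∘ e.symm) y (𝐞 j) * w j := by
    have hv : w = ∑ k, w k • 𝐞 k := by simpa using ((𝐞).sum_repr w).symm
    conv_lhs => rw [hv]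
    rw [map_sum]
    simp only [map_smul, smul_eq_mul, mul_comm]
  rw [hw] at h2
  exact h2

/-- The `i`-th component is `∑ⱼ ∂ⱼf · J(dxʲ, dxⁱ)`, and the components of `J` are smooth. -/
theorem PoissonTensor.contDiffOn_coordinateField (J : PoissonTensor n M)
    (he : e ∈ IsManifold.maximalAtlas (𝓡 n) ∞ M) {f : M → ℝ}
    (hf : ContMDiff (𝓡 n) 𝓘(ℝ, ℝ) ∞ f) :
    ContDiffOn ℝ ∞ (coordinateField (J.hamiltonianVectorField f) e) e.target := by
  refine (contDiffOn_piLp 2).2 fun i => ?_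
  have hsum : ContDiffOn ℝ ∞ (fun y => ∑ j, fderiv ℝ (f ∘ e.symm) y (𝐞 j) * J.toFun (e.symm y)
      ((EuclideanSpace.proj j : 𝔼 →L[ℝ] ℝ).toLinearMap ∘ₗ
        (mfderiv (𝓡 n) (𝓡 n) e (e.symm y)).toLinearMap)
      ((EuclideanSpace.proj i : 𝔼 →L[ℝ] ℝ).toLinearMap ∘ₗ
        (mfderiv (𝓡 n) (𝓡 n) e (e.symm y)).toLinearMap)) e.target :=
    ContDiffOn.sum fun j _ =>
      (((contDiffOn_comp_symm he hf).fderiv_of_isOpen e.open_target (by simp)).clm_apply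
        contDiffOn_const).mul (J.smooth e he _ _)
  refine hsum.congr fun y hy => ?_
  have h1 := J.apply_hamiltonianVectorField f (e.symm y)
    ((EuclideanSpace.proj i : 𝔼 →L[ℝ] ℝ).toLinearMap ∘ₗ
        (mfderiv (𝓡 n) (𝓡 n) e (e.symm y)).toLinearMap)
  refine Eq.trans h1 ?_
  rw [differential_eq_sum he hf hy, map_sum, LinearMap.sum_apply]
  simp only [map_smul, LinearMap.smul_apply, smul_eq_mul]

theorem bracket_eq_zero_of_notMem_tsupport (J : PoissonTensor n M) (f : M → ℝ) {h : M → ℝ} {x : M}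
    (hx : x ∉ tsupport h) : bracket J.toFun f h x = 0 := by
  have h0 : h =ᶠ[𝓝 x] fun _ => 0 := notMem_tsupport_iff_eventuallyEq.1 hx
  have h1 : differential (n := n) h x = 0 := by
    have h2 : mfderiv (𝓡 n) 𝓘(ℝ, ℝ) h x = mfderiv (𝓡 n) 𝓘(ℝ, ℝ) (fun _ : M => (0 : ℝ)) x :=
      h0.mfderiv_eq
    rw [mfderiv_const] at h2
    exact LinearMap.ext fun v => DFunLike.congr_fun h2 v
  rw [bracket, h1, map_zero]

/-- The chart expression, extended by zero, of a smooth function with compact support in the chart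
domain. -/
theorem exists_contDiff_extension [T2Space M] (he : e ∈ IsManifold.maximalAtlas (𝓡 n) ∞ M)
    {h : M → ℝ} (hh : ContMDiff (𝓡 n) 𝓘(ℝ, ℝ) ∞ h) (hc : HasCompactSupport h)
    (hs : tsupport h ⊆ e.source) :
    ∃ φ : 𝔼 → ℝ, ContDiff ℝ ∞ φ ∧ HasCompactSupport φ ∧ tsupport φ ⊆ e.target ∧
      EqOn φ (h ∘ e.symm) e.target := by
  set φ : 𝔼 → ℝ := e.target.indicator (h ∘ e.symm)
  have hφ : EqOn φ (h ∘ e.symm) e.target := fun y hy => indicator_of_mem hy _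
  have hK : IsCompact (e '' tsupport h) := hc.isCompact.image_of_continuousOn (e.continuousOn.mono hs)
  -- The compact image of the support is closed in the whole model space, so the closure of the
  -- support of `φ` cannot reach the boundary of `e.target`.
  have hsub : tsupport φ ⊆ e '' tsupport h := by
    refine closure_minimal (fun y hy => ?_) hK.isClosed
    have hyt : y ∈ e.target := by
      by_contra hyt
      exact hy (indicator_of_notMem hyt _)
    refine ⟨e.symm y, subset_tsupport _ ?_, e.right_inv hyt⟩
    rw [Function.mem_support, hφ hyt] at hy
    exact hy
  have hst : tsupport φ ⊆ e.target := hsub.trans (by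
    rintro _ ⟨x, hx, rfl⟩
    exact e.map_source (hs hx))
  refine ⟨φ, contMDiff_iff_contDiff.1 (contMDiff_of_tsupport fun y hy => ?_),
    hK.of_isClosed_subset (isClosed_tsupport φ) hsub, hst, hφ⟩
  have hy' := e.open_target.mem_nhds (hst hy)
  exact (((contDiffOn_comp_symm he hh).contDiffAt hy').congr_of_eventuallyEq
    (hφ.eventuallyEq_of_mem hy')).contMDiffAt

theorem bracket_finset_sum (J : PoissonTensor n M) (f : M → ℝ) {ι : Type*} (s : Finset ι)
    {h : ι → M → ℝ} (hh : ∀ i, ContMDiff (𝓡 n) 𝓘(ℝ, ℝ) ∞ (h i)) (x : M) :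
    bracket J.toFun f (fun z => ∑ i ∈ s, h i z) x = ∑ i ∈ s, bracket J.toFun f (h i) x := by
  have h1 : differential (n := n) (fun z => ∑ i ∈ s, h i z) x
      = ∑ i ∈ s, differential (n := n) (h i) x := by
    classical
    induction s using Finset.induction_on with
    | empty =>
      refine LinearMap.ext fun v => ?_
      simp [differential, mvfderiv_const]
    | insert a s ha ih =>
      have hs : ContMDiff (𝓡 n) 𝓘(ℝ, ℝ) ∞ fun z => ∑ i ∈ s, h i z :=
        contMDiff_finsetSum fun i _ => hh i
      have h2 := mvfderiv_add ((hh a).mdifferentiableAt (x := x) (by simp))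
        (hs.mdifferentiableAt (x := x) (by simp))
      rw [Finset.sum_insert ha, ← ih]
      simp only [Finset.sum_insert ha]
      exact congrArg ContinuousLinearMap.toLinearMap h2
  simp only [bracket, h1, map_sum]

variable [T2Space M] [IsManifold (𝓡 n) ∞ M] [MeasurableSpace M] [BorelSpace M]

theorem PoissonTensor.integral_bracket_eq_zero_of_tsupport_subset_source
    (J : PoissonTensor n M) (ν : VolumeForm n M) (hJν : IsUnimodular J ν)
    (he : e ∈ IsManifold.maximalAtlas (𝓡 n) ∞ M) {f h : M → ℝ}
    (hf : ContMDiff (𝓡 n) 𝓘(ℝ, ℝ) ∞ f) (hh : ContMDiff (𝓡 n) 𝓘(ℝ, ℝ) ∞ h)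
    (hc : HasCompactSupport h) (hs : tsupport h ⊆ e.source) :
    Integrable (bracket J.toFun f h) ν.measure ∧ ∫ x, bracket J.toFun f h x ∂ν.measure = 0 := by
  set X := coordinateField (J.hamiltonianVectorField f) e with hXdef
  have hX : ContDiffOn ℝ ∞ X e.target := J.contDiffOn_coordinateField he hf
  have hρ := ν.contDiffOn_coordinate he
  obtain ⟨φ, hφ, hφc, hφs, hφe⟩ := exists_contDiff_extension he hh hc hs
  obtain ⟨hint, hzero⟩ := integral_abs_mul_fderiv_eq_zero e.open_target
    (hρ.of_le (by simp)) (fun y hy => ν.coordinate_ne_zero he hy) (hX.of_le (by simp))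
    (fun y hy => (hJν f hf).coordinate_eq_zero he hX hy) (hφ.of_le (by simp)) hφc hφs
  have hbr : EqOn (bracket J.toFun f h ∘ e.symm) (fun y => fderiv ℝ φ y (X y)) e.target := by
    intro y hy
    have := (hφe.eventuallyEq_of_mem (e.open_target.mem_nhds hy)).fderiv_eq (𝕜 := ℝ)
    simp only [Function.comp_apply, this]
    exact J.bracket_eq_fderiv he f hh hy
  have hcont : ContinuousOn (fun y => fderiv ℝ φ y (X y)) e.target :=
    (hφ.continuous_fderiv (by simp)).continuousOn.clm_apply hX.continuousOn
  have hcont' : ContinuousOn (bracket J.toFun f h) e.source := by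
    refine (hcont.comp e.continuousOn e.mapsTo).congr fun x hx => ?_
    have := hbr (e.map_source hx)
    rw [Function.comp_apply, e.left_inv hx] at this
    exact this
  have hmeas : AEStronglyMeasurable (bracket J.toFun f h) (ν.chartMeasure e) := by
    rw [← ν.restrict_chartMeasure e]
    exact hcont'.aestronglyMeasurable e.open_source.measurableSet
  have hdens : AEMeasurable (fun y => ENNReal.ofReal (ν.chartDensity e y))
      (volume.restrict e.target) :=
    (hρ.continuousOn.abs.aemeasurable e.open_target.measurableSet).ennreal_ofReal
  have hvanish : ∀ x, x ∉ e.source → bracket J.toFun f h x = 0 := fun x hx =>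
    bracket_eq_zero_of_notMem_tsupport J f fun hx' => hx (hs hx')
  have hvanish' : ∀ y, y ∉ e.target → |ν.coordinate e y| * fderiv ℝ φ y (X y) = 0 := by
    intro y hy
    have h1 : fderiv ℝ φ y = 0 :=
      image_eq_zero_of_notMem_tsupport fun h => hy (hφs (tsupport_fderiv_subset ℝ h))
    simp [h1]
  have hcongr : EqOn (fun y => (ENNReal.ofReal (ν.chartDensity e y)).toReal •
      bracket J.toFun f h (e.symm y)) (fun y => |ν.coordinate e y| * fderiv ℝ φ y (X y))
      e.target := by
    intro y hy
    have := hbr hy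
    simp only [Function.comp_apply] at this
    simp only [this, smul_eq_mul, ν.chartDensity_eq_abs_coordinate,
      ENNReal.toReal_ofReal (abs_nonneg _)]
  -- The bracket vanishes off `e.source`, where `ν.measure` becomes the chart measure; pulled back
  -- by `e.symm`, the integrand vanishes off `e.target`, which gives the Lebesgue integral over the
  -- whole model space.
  constructor
  · rw [← integrableOn_iff_integrable_of_support_subset
      (fun x hx => not_imp_comm.1 (hvanish x) hx), IntegrableOn, ν.restrict_measure he,
      VolumeForm.chartMeasure, integrable_map_measure hmeas (ν.aemeasurable_symm e),
      integrable_withDensity_iff_integrable_smul₀' hdens (ae_of_all _ fun _ => ENNReal.ofReal_lt_top)]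
    exact (integrableOn_congr_fun hcongr e.open_target.measurableSet).2 hint.integrableOn
  · rw [← setIntegral_eq_integral_of_forall_compl_eq_zero hvanish, ν.restrict_measure he,
      VolumeForm.chartMeasure, integral_map (ν.aemeasurable_symm e) hmeas,
      integral_withDensity_eq_integral_toReal_smul₀ hdens
        (ae_of_all _ fun _ => ENNReal.ofReal_lt_top),
      setIntegral_congr_fun e.open_target.measurableSet hcongr,
      setIntegral_eq_integral_of_forall_compl_eq_zero hvanish', hzero]

end Poisson

end PoissonManifold

end

/-! ### Globalisation by a partition of unity -/

theorem mainTheorem3 {n : ℕ} {M : Type*} [TopologicalSpace M] [T2Space M]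
    [SecondCountableTopology M] [ChartedSpace (EuclideanSpace ℝ (Fin n)) M]
    [IsManifold (𝓡 n) ∞ M] [MeasurableSpace M] [BorelSpace M]
    (J : PoissonManifold.PoissonTensor n M) (ν : PoissonManifold.VolumeForm n M)
    (hJν : PoissonManifold.IsUnimodular J ν)
    (f h : M → ℝ) (hf : ContMDiff (𝓡 n) 𝓘(ℝ, ℝ) ∞ f) (hh : ContMDiff (𝓡 n) 𝓘(ℝ, ℝ) ∞ h)
    (hc : HasCompactSupport h) :
    Integrable (fun x => J.toFun x (PoissonManifold.differential f x)
        (PoissonManifold.differential h x)) ν.measure ∧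
      ∫ x, J.toFun x (PoissonManifold.differential f x)
        (PoissonManifold.differential h x) ∂ν.measure = 0 := by
  have : LocallyCompactSpace M := ChartedSpace.locallyCompactSpace (EuclideanSpace ℝ (Fin n)) M
  obtain ⟨ρ, hρ⟩ := SmoothPartitionOfUnity.exists_isSubordinate_chartAt_source_of_isClosed
    (𝓡 n) (isClosed_tsupport h)
  -- Local finiteness and compactness leave finitely many indices, so only finite sums are
  -- integrated.
  have hfin : {i | (Function.support (ρ i) ∩ tsupport h).Nonempty}.Finite :=
    ρ.locallyFinite.finite_nonempty_inter_compact hc.isCompact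
  set s := hfin.toFinset with hs
  -- The `ρ i` sum to 1 only on `tsupport h`; elsewhere both sides vanish because `h` does.
  have hsum : h = fun x => ∑ i ∈ s, ρ i x * h x := by
    funext x
    by_cases hx : x ∈ tsupport h
    · rw [← Finset.sum_mul, ρ.sum_finsupport' x hx, one_mul]
      intro i hi
      rw [hs, Set.Finite.mem_toFinset]
      exact ⟨x, (ρ.mem_finsupport x).1 hi, hx⟩
    · simp [image_eq_zero_of_notMem_tsupport hx]
  have hsm : ∀ i, ContMDiff (𝓡 n) 𝓘(ℝ, ℝ) ∞ fun x => ρ i x * h x := fun i =>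
    (ρ i).contMDiff.mul hh
  have hi : ∀ i, Integrable (PoissonManifold.bracket J.toFun f fun x => ρ i x * h x) ν.measure ∧
      ∫ x, PoissonManifold.bracket J.toFun f (fun x => ρ i x * h x) x ∂ν.measure = 0 := fun i =>
    J.integral_bracket_eq_zero_of_tsupport_subset_source ν hJν
      (IsManifold.chart_mem_maximalAtlas (i : M)) hf (hsm i) hc.mul_left
      (tsupport_mul_subset_left.trans (hρ i))
  have hbr : (fun x => J.toFun x (PoissonManifold.differential f x)
        (PoissonManifold.differential h x))
      = fun x => ∑ i ∈ s, PoissonManifold.bracket J.toFun f (fun x => ρ i x * h x) x := by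
    funext x
    rw [← PoissonManifold.bracket_finset_sum J f s hsm, ← hsum]
    rfl
  rw [hbr]
  refine ⟨integrable_finsetSum _ fun i _ => (hi i).1, ?_⟩
  rw [integral_finsetSum _ fun i _ => (hi i).1]
  exact Finset.sum_eq_zero fun i _ => (hi i).2
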